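/- Let $\mathcal A$ be an arrangement of $d=|\mathcal A|$ distinct lines in the complex projective plane $\mathbb P^2$, not a pencil (that is, the lines do not all pass through one point), with defining equation $f=0$, where $f\in S=\mathbb C[x,y,z]$ is the product of linear forms defining the lines. The multiplicity of a point is the number of lines of $\mathcal A$ through it; a multiple point is a point of multiplicity at least $2$. Let $d_1$ be the minimal degree of a nonzero homogeneous Jacobian syzygy of $f$, i.e. of a triple $(a,b,c)\ne 0$ of homogeneous polynomials of the same degree in $S$ with $af_x+bf_y+cf_z=0$. Let $N$ be the minimal number of lines in $\mathbb P^2$ whose union contains all multiple points of $\mathcal A$. Suppose that $\mathcal A$ has a point of multiplicity $m\ge 2$ such that $d_1=m-1$ or $d_1=d-m$. Then $(\ast)$ $N\le d_1+1$, and moreover there are at most $d_1+1$ lines belonging to $\mathcal A$ whose union contains all multiple points of $\mathcal A$. In particular, property $(\ast)$ holds for $\mathcal A$ in each of the following cases. 1. $\mathcal A$ has only double points (every multiple point has multiplicity $2$) and $d\ge 3$. 2. $\mathcal A$ has only double points except for $n_3$ triple points, where $1\le n_3\le 3$, and $d\ge 4$. 3. $\mathcal A$ has a point of multiplicity $m$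 with $2m\ge d$. 4. $\mathcal A$ is supersolvable, i.e. it has a modular point: a multiple point $p$ such that for every other multiple point $q$ the line joining $p$ and $q$ belongs to $\mathcal A$. -/

import Mathlib

open scoped LinearAlgebra.Projectivization

noncomputable section

namespace LineArrangement

/-- Points of the complex projective plane. -/
abbrev Point : Type := ℙ ℂ (Fin 3 → ℂ)

/-- Lines of the complex projective plane, given by their coefficient vectors up to scaling:
`(α : β : γ)` is the line `α x + β y + γ z = 0`. -/
abbrev Line : Type := ℙ ℂ (Fin 3 → ℂ)

/-- The point `p` lies on the line `L` (the dot product of coordinates vanishes). -/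
def OnLine (p : Point) (L : Line) : Prop := Projectivization.orthogonal p L

/-- A line arrangement is a finite set `A` of lines in the plane. It is a pencil if all of
its lines pass through one point. -/
def IsPencil (A : Finset Line) : Prop := ∃ p : Point, ∀ L ∈ A, OnLine p L

open Classical in
/-- The multiplicity of the point `p` in the arrangement: the number of lines through `p`. -/
def mult (A : Finset Line) (p : Point) : ℕ := (A.filter fun L => OnLine p L).card

/-- A multiple point is a point on at least two lines of the arrangement. -/
def IsMultiplePoint (A : Finset Line) (p : Point) : Prop := 2 ≤ mult A p

/-- A linear form defining the line `L` (well defined up to a nonzero constant factor). -/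
def linearForm (L : Line) : MvPolynomial (Fin 3) ℂ :=
  ∑ i, MvPolynomial.C (L.rep i) * MvPolynomial.X i

/-- A defining polynomial `f` of the arrangement, the product of the linear forms of its lines
(well defined up to a nonzero constant factor). -/
def definingPoly (A : Finset Line) : MvPolynomial (Fin 3) ℂ := ∏ L ∈ A, linearForm L

/-- `ρ = (a, b, c)` is a Jacobian syzygy of `f`: `a f_x + b f_y + c f_z = 0`. -/
def IsJacobianSyzygy (f : MvPolynomial (Fin 3) ℂ) (ρ : Fin 3 → MvPolynomial (Fin 3) ℂ) : Prop :=
  ∑ i, ρ i * MvPolynomial.pderiv i f = 0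

/-- The minimal degree of a nonzero homogeneous Jacobian syzygy of `f`. (For homogeneous `f`
nonzero ones exist: a constant one if the partial derivatives all vanish, a Koszul one such as
`(f_y, -f_x, 0)` otherwise.) -/
def mdr (f : MvPolynomial (Fin 3) ℂ) : ℕ :=
  sInf {k : ℕ | ∃ ρ : Fin 3 → MvPolynomial (Fin 3) ℂ,
    ρ ≠ 0 ∧ (∀ i, (ρ i).IsHomogeneous k) ∧ IsJacobianSyzygy f ρ}

/-- The first exponent `d₁` of the arrangement. -/
def firstExponent (A : Finset Line) : ℕ := mdr (definingPoly A)

/-- The lines in `B` contain all the multiple points of `A`. -/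
def CoversMultiplePoints (A B : Finset Line) : Prop :=
  ∀ p : Point, IsMultiplePoint A p → ∃ L ∈ B, OnLine p L

/-- The minimal number of lines in the plane whose union contains all the multiple points
of `A` (such sets of lines exist, `A` itself is one). -/
def coverNumber (A : Finset Line) : ℕ :=
  sInf {n : ℕ | ∃ B : Finset Line, B.card = n ∧ CoversMultiplePoints A B}

/-- The minimal number of lines containing all multiple points is at most `d₁ + 1`, and at most
`d₁ + 1` lines containing all multiple points can be chosen in the arrangement. -/
def SmallCover (A : Finset Line) : Prop :=
  coverNumber A ≤ firstExponent A + 1 ∧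
    ∃ B ⊆ A, B.card ≤ firstExponent A + 1 ∧ CoversMultiplePoints A B

/-- A modular point is a multiple point connected to every other multiple point by a line
of the arrangement. -/
def IsModularPoint (A : Finset Line) (p : Point) : Prop :=
  IsMultiplePoint A p ∧
    ∀ q : Point, q ≠ p → IsMultiplePoint A q → ∃ L ∈ A, OnLine p L ∧ OnLine q L

/-- A line arrangement in the plane (not a pencil) is supersolvable if it has a modular point. -/
def IsSupersolvable (A : Finset Line) : Prop := ∃ p : Point, IsModularPoint A p

end LineArrangement

end

namespace LineArrangement

open MvPolynomial

/-! A Jacobian syzygy `ρ` of degree `k = d₁` is a vector field killing `f`, hence tangent to every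
line of `A`. At a multiple point two tangency conditions make `ρ` parallel to the Euler field `E`,
so `ρ × E` (degree `k + 1`) vanishes there. If `k + 1` lines divide `ρ × E`, then `ρ = 0`
(`eq_zero_of_lin_dvd_eulerCross`).

For a point `p` of multiplicity `m`, the form `det(p, ρ, E)` is divisible by the `m` lines through
`p`. If `d₁ + m < d` it is nonzero, so `m ≤ d₁ + 1`; when `m = d₁ + 1` it is a constant times the
product of these lines and vanishes at all multiple points, so the lines through `p` are a cover. If
instead `d ≤ d₁ + m`, the `d - m` lines off `p` and one line through `p` suffice.

With only double points, or few triple ones, each of enough lines carries more than `k + 1` multiple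
points, hence divides `ρ × E`; this forces `d ≤ d₁ + m`. -/

/-! ### Linear forms and divisibility by products of lines. -/

/-- The linear form with coefficient vector `v`. -/
noncomputable def lin (v : Fin 3 → ℂ) : MvPolynomial (Fin 3) ℂ := ∑ i, C (v i) * X i

lemma linearForm_eq_lin (L : Line) : linearForm L = lin L.rep := rfl

lemma eval_lin (v x : Fin 3 → ℂ) : eval x (lin v) = v ⬝ᵥ x := by
  simp [lin, dotProduct]

lemma lin_eq (v : Fin 3 → ℂ) : lin v = C (v 0) * X 0 + C (v 1) * X 1 + C (v 2) * X 2 := by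
  simp [lin, Fin.sum_univ_three]

lemma isHomogeneous_lin (v : Fin 3 → ℂ) : (lin v).IsHomogeneous 1 :=
  IsHomogeneous.sum _ _ _ fun _ _ => isHomogeneous_C_mul_X _ _

lemma lin_eq_zero_iff {v : Fin 3 → ℂ} : lin v = 0 ↔ v = 0 := by
  refine ⟨fun h => ?_, fun h => by simp [lin, h]⟩
  ext i
  have := eval_lin v (Pi.single i 1)
  simpa [h] using this.symm

lemma prime_lin {v : Fin 3 → ℂ} (hv : v ≠ 0) : Prime (lin v) := by
  have h0 : lin v ≠ 0 := fun h => hv (lin_eq_zero_iff.1 h)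
  refine (irreducible_of_totalDegree_eq_one ((isHomogeneous_lin v).totalDegree h0) ?_).prime
  intro r hr
  rw [isUnit_iff_ne_zero]
  rintro rfl
  exact h0 (MvPolynomial.ext _ _ fun i => by simpa using hr i)

lemma eval_smul_of_isHomogeneous {Q : MvPolynomial (Fin 3) ℂ} {n : ℕ} (hQ : Q.IsHomogeneous n)
    (c : ℂ) (x : Fin 3 → ℂ) : eval (c • x) Q = c ^ n * eval x Q := by
  rw [eval_eq, eval_eq, Finset.mul_sum]
  refine Finset.sum_congr rfl fun s hs => ?_
  have hd : ∑ i ∈ s.support, s i = n := (hQ.degree_eq_sum_deg_support hs).symm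
  simp only [Pi.smul_apply, smul_eq_mul, mul_pow, Finset.prod_mul_distrib,
    Finset.prod_pow_eq_pow_sum, hd]
  ring

/-- A polynomial vanishing on a plane through the origin is divisible by the equation of the
plane. -/
lemma lin_dvd_of_eval_eq_zero {v : Fin 3 → ℂ} (hv : v ≠ 0) {Q : MvPolynomial (Fin 3) ℂ}
    (h : ∀ x, v ⬝ᵥ x = 0 → eval x Q = 0) : lin v ∣ Q := by
  obtain ⟨i, hi⟩ := Function.ne_iff.1 hv
  -- `φ` is composition with the projection onto the plane along `w`: it kills `Q`, yet is the
  -- identity modulo `lin v`.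
  set w : Fin 3 → ℂ := Pi.single i (v i)⁻¹
  have hw : v ⬝ᵥ w = 1 := by simpa [w] using mul_inv_cancel₀ hi
  let φ : MvPolynomial (Fin 3) ℂ →ₐ[ℂ] MvPolynomial (Fin 3) ℂ :=
    aeval fun j => X j - lin v * C (w j)
  have hφ : φ Q = 0 := by
    refine MvPolynomial.funext fun x => ?_
    have : eval x (φ Q) = eval (x - (v ⬝ᵥ x) • w) Q := by
      have key : ((aeval x).comp φ) = aeval (x - (v ⬝ᵥ x) • w) := by
        ext j
        simp [φ, eval_lin]
      simpa [coe_aeval_eq_eval] using DFunLike.congr_fun key Q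
    rw [this, map_zero]
    exact h _ (by simp [dotProduct_sub, hw])
  have hmk : ((Ideal.Quotient.mkₐ ℂ (Ideal.span {lin v})).comp φ) =
      Ideal.Quotient.mkₐ ℂ (Ideal.span {lin v}) := by
    ext j
    simp only [φ, AlgHom.comp_apply, aeval_X, map_sub, map_mul]
    have : Ideal.Quotient.mkₐ ℂ (Ideal.span {lin v}) (lin v) = 0 :=
      Ideal.Quotient.eq_zero_iff_mem.2 (Ideal.mem_span_singleton_self _)
    rw [this]; simp
  have := DFunLike.congr_fun hmk Q
  rw [AlgHom.comp_apply, hφ, map_zero] at this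
  exact Ideal.mem_span_singleton.1 (Ideal.Quotient.eq_zero_iff_mem.1 this.symm)

lemma exists_smul_of_crossProduct_eq_zero {v w : Fin 3 → ℂ} (hv : v ≠ 0)
    (h : crossProduct v w = 0) : ∃ c : ℂ, w = c • v := by
  obtain ⟨i, hi⟩ := Function.ne_iff.1 hv
  refine ⟨w i / v i, ?_⟩
  rw [cross_apply] at h
  have h0 := congr_fun h 0
  have h1 := congr_fun h 1
  have h2 := congr_fun h 2
  simp at h0 h1 h2
  ext j
  rw [Pi.smul_apply, smul_eq_mul, div_mul_eq_mul_div, eq_div_iff hi]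
  fin_cases i <;> fin_cases j <;> simp <;> grind

lemma eq_of_rep_eq_smul {p q : Point} {c : ℂ} (h : q.rep = c • p.rep) : p = q := by
  rw [← p.mk_rep, ← q.mk_rep, Projectivization.mk_eq_mk_iff']
  have hc : c ≠ 0 := by
    rintro rfl
    exact q.rep_nonzero (by simpa using h)
  exact ⟨c⁻¹, by rw [h, smul_smul, inv_mul_cancel₀ hc, one_smul]⟩

lemma onLine_iff (p : Point) (L : Line) : OnLine p L ↔ L.rep ⬝ᵥ p.rep = 0 := by
  rw [OnLine]
  conv_lhs => rw [← p.mk_rep, ← L.mk_rep]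
  rw [Projectivization.orthogonal_mk, dotProduct_comm]

lemma lin_rep_dvd_iff {L M : Line} : lin L.rep ∣ lin M.rep ↔ L = M := by
  refine ⟨fun ⟨c, hc⟩ => ?_, fun h => h ▸ dvd_rfl⟩
  by_contra hne
  have hcr : crossProduct L.rep M.rep ≠ 0 := fun h0 =>
    hne (by
      obtain ⟨a, ha⟩ := exists_smul_of_crossProduct_eq_zero L.rep_nonzero h0
      exact eq_of_rep_eq_smul ha)
  refine hcr ?_
  have key : ∀ x, L.rep ⬝ᵥ x = 0 → M.rep ⬝ᵥ x = 0 := fun x hx => by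
    rw [← eval_lin, hc, map_mul, eval_lin, hx, zero_mul]
  simp only [dotProduct, Fin.sum_univ_three] at key
  rw [cross_apply]
  have h0 := key ![0, L.rep 2, -L.rep 1] (by simp; ring)
  have h1 := key ![-L.rep 2, 0, L.rep 0] (by simp; ring)
  have h2 := key ![L.rep 1, -L.rep 0, 0] (by simp; ring)
  simp at h0 h1 h2
  ext i
  fin_cases i <;> simp
  · linear_combination -h0
  · linear_combination -h1
  · linear_combination -h2

lemma prod_linearForm_dvd {B : Finset Line} {Q : MvPolynomial (Fin 3) ℂ}
    (h : ∀ L ∈ B, lin L.rep ∣ Q) : ∏ L ∈ B, linearForm L ∣ Q := by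
  refine Finset.prod_dvd_of_isRelPrime (fun L _ M _ hLM => ?_) h
  exact ((prime_lin L.rep_nonzero).irreducible.isRelPrime_iff_not_dvd).2
    fun hd => hLM (lin_rep_dvd_iff.1 hd)

lemma isHomogeneous_prod_linearForm (B : Finset Line) :
    (∏ L ∈ B, linearForm L).IsHomogeneous B.card := by
  have := IsHomogeneous.prod B linearForm (fun _ => 1) fun L _ => isHomogeneous_lin L.rep
  simpa using this

lemma prod_linearForm_ne_zero (B : Finset Line) : ∏ L ∈ B, linearForm L ≠ 0 :=
  Finset.prod_ne_zero_iff.2 fun L _ => (prime_lin L.rep_nonzero).ne_zero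

/-- A form of degree at most `|B|` divisible by the lines of `B` is a constant multiple of their
product. -/
lemma exists_eq_C_mul_prod {B : Finset Line} {Q : MvPolynomial (Fin 3) ℂ} {n : ℕ}
    (hQ : Q.IsHomogeneous n) (hn : n ≤ B.card) (h : ∀ L ∈ B, lin L.rep ∣ Q) :
    ∃ c : ℂ, Q = C c * ∏ L ∈ B, linearForm L := by
  obtain ⟨u, hu⟩ := prod_linearForm_dvd h
  by_cases h0 : u = 0
  · exact ⟨0, by simp [hu, h0]⟩
  have hdeg := totalDegree_mul_of_isDomain (prod_linearForm_ne_zero B) h0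
  rw [(isHomogeneous_prod_linearForm B).totalDegree (prod_linearForm_ne_zero B), ← hu] at hdeg
  have := hQ.totalDegree_le
  obtain ⟨c, hc⟩ : ∃ c, u = C c := ⟨_, totalDegree_eq_zero_iff_eq_C.1 (by omega)⟩
  exact ⟨c, by rw [hu, hc, mul_comm]⟩

lemma card_le_of_isHomogeneous {B : Finset Line} {Q : MvPolynomial (Fin 3) ℂ} {n : ℕ}
    (hQ : Q.IsHomogeneous n) (h0 : Q ≠ 0) (h : ∀ L ∈ B, lin L.rep ∣ Q) : B.card ≤ n := by
  obtain ⟨u, hu⟩ := prod_linearForm_dvd h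
  have hu0 : u ≠ 0 := by rintro rfl; simp [hu] at h0
  have hdeg := totalDegree_mul_of_isDomain (prod_linearForm_ne_zero B) hu0
  rw [(isHomogeneous_prod_linearForm B).totalDegree (prod_linearForm_ne_zero B), ← hu,
    hQ.totalDegree h0] at hdeg
  omega

/-! ### Zeros of a form on a line. -/

/-- Since `α` kills `t`, `v` and `x`, their determinant vanishes; independence of `v` and `x` makes
the coefficient of `t` in a nontrivial relation nonzero. -/
lemma exists_eq_smul_add_smul {α v x t : Fin 3 → ℂ} (hα : α ≠ 0) (hv : α ⬝ᵥ v = 0)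
    (hx : α ⬝ᵥ x = 0) (ht : α ⬝ᵥ t = 0) (hx0 : x ≠ 0) (hvx : ∀ b : ℂ, v ≠ b • x) :
    ∃ a b : ℂ, t = a • v + b • x := by
  have hM : (Matrix.of ![t, v, x]).det = 0 := by
    rw [← Matrix.exists_mulVec_eq_zero_iff]
    refine ⟨α, hα, ?_⟩
    ext i
    fin_cases i <;> simp [Matrix.mulVec, dotProduct_comm _ α, hv, hx, ht]
  obtain ⟨w, hw0, hw⟩ := Matrix.exists_vecMul_eq_zero_iff.2 hM
  have hw' : w 0 • t + w 1 • v + w 2 • x = 0 := by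
    rw [← hw]
    ext i
    simp [Matrix.vecMul, dotProduct, Fin.sum_univ_three]
  have h0 : w 0 ≠ 0 := by
    intro h0
    by_cases h1 : w 1 = 0
    · have h2 : w 2 = 0 := by simpa [h0, h1, hx0] using hw'
      exact hw0 (by ext i; fin_cases i <;> simp [h0, h1, h2])
    · refine hvx (-(w 1)⁻¹ * w 2) ?_
      rw [h0, zero_smul, zero_add] at hw'
      rw [mul_smul, neg_smul, ← smul_neg, ← eq_neg_of_add_eq_zero_left hw', smul_smul,
        inv_mul_cancel₀ h1, one_smul]
  refine ⟨-(w 0)⁻¹ * w 1, -(w 0)⁻¹ * w 2, ?_⟩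
  rw [mul_smul, mul_smul, ← smul_add, neg_smul, ← smul_neg]
  rw [add_assoc] at hw'
  rw [← eq_neg_of_add_eq_zero_left hw', smul_smul, inv_mul_cancel₀ h0, one_smul]

/-- A form of degree `n` with more than `n` zeros on a line vanishes on the line. -/
lemma lin_dvd_of_zeros {L : Line} {Q : MvPolynomial (Fin 3) ℂ} {n : ℕ} (hQ : Q.IsHomogeneous n)
    {T : Finset Point} (hT : n < T.card) (hTL : ∀ t ∈ T, OnLine t L)
    (h0 : ∀ t ∈ T, eval t.rep Q = 0) : lin L.rep ∣ Q := by
  refine lin_dvd_of_eval_eq_zero L.rep_nonzero fun x hx => ?_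
  by_contra hQx
  -- As `Q` does not vanish at `x`, all points of `T` lie in the affine chart `v + s • x` of the
  -- line, where `x` is the point at infinity.
  have hne : ∀ t ∈ T, ∀ b : ℂ, t.rep ≠ b • x := by
    intro t ht b hb
    have hb0 : b ≠ 0 := by
      rintro rfl
      exact t.rep_nonzero (by simpa using hb)
    have := h0 t ht
    rw [hb, eval_smul_of_isHomogeneous hQ] at this
    simp_all
  obtain ⟨t₀, ht₀⟩ : T.Nonempty := Finset.card_pos.1 (by omega)
  have hx0 : x ≠ 0 := by
    rintro rfl
    have h1 := eval_smul_of_isHomogeneous hQ 0 t₀.rep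
    rw [zero_smul, h0 t₀ ht₀, mul_zero] at h1
    exact hQx h1
  set v := t₀.rep with hv
  have hspan : ∀ t ∈ T, ∃ a r : ℂ, a ≠ 0 ∧ t.rep = a • (v + r • x) := by
    intro t ht
    obtain ⟨a, b, hab⟩ := exists_eq_smul_add_smul L.rep_nonzero ((onLine_iff _ _).1 (hTL _ ht₀)) hx
      ((onLine_iff _ _).1 (hTL _ ht)) hx0 (hne t₀ ht₀)
    have ha : a ≠ 0 := by
      rintro rfl
      exact hne t ht b (by simpa using hab)
    exact ⟨a, b / a, ha, by rw [hab, smul_add, smul_smul, mul_div_cancel₀ _ ha]⟩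
  choose! a r ha hr using hspan
  have haeval : ∀ (p q : Fin 3 → ℂ) (s : ℂ), Polynomial.eval s
      (aeval (fun i => Polynomial.C (p i) + Polynomial.C (q i) * Polynomial.X) Q) =
      eval (p + s • q) Q := by
    intro p q s
    have key : ((Polynomial.aeval s).comp (aeval
        (fun i => Polynomial.C (p i) + Polynomial.C (q i) * Polynomial.X) :
          MvPolynomial (Fin 3) ℂ →ₐ[ℂ] Polynomial ℂ)) = aeval (p + s • q) := by
      ext j
      simp [mul_comm s]
    simpa [coe_aeval_eq_eval, Polynomial.coe_aeval_eq_eval] using DFunLike.congr_fun key Q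
  have hF : (aeval (fun i => Polynomial.C (v i) + Polynomial.C (x i) * Polynomial.X) Q :
      Polynomial ℂ) = 0 := by
    refine Polynomial.eq_zero_of_natDegree_lt_card_of_eval_eq_zero' _ (T.image r) ?_ ?_
    · intro s hs
      obtain ⟨t, ht, rfl⟩ := Finset.mem_image.1 hs
      rw [haeval]
      have := h0 t ht
      rw [hr t ht, eval_smul_of_isHomogeneous hQ] at this
      exact (mul_eq_zero.1 this).resolve_left (pow_ne_zero _ (ha t ht))
    · rw [Finset.card_image_of_injOn]
      · refine lt_of_le_of_lt (aeval_natDegree_le Q hQ.totalDegree_le _ (n := 1) fun i => ?_)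
          (by simpa using hT)
        compute_degree
      · intro t ht t' ht' htt
        refine eq_of_rep_eq_smul (c := a t' * (a t)⁻¹) ?_
        rw [hr t' ht', hr t ht, htt, smul_smul, mul_assoc, inv_mul_cancel₀ (ha t ht), mul_one]
  -- The opposite chart `x + s • v` agrees with the first up to scaling for `s ≠ 0`; its value at `s
  -- = 0` is `Q` at `x`.
  have hG : (aeval (fun i => Polynomial.C (x i) + Polynomial.C (v i) * Polynomial.X) Q :
      Polynomial ℂ) = 0 := by
    refine Polynomial.eq_zero_of_infinite_isRoot _
      ((Set.finite_singleton (0 : ℂ)).infinite_compl.mono fun s hs => ?_)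
    have hs0 : s ≠ 0 := hs
    change Polynomial.eval s _ = 0
    rw [haeval]
    have h1 : x + s • v = s • (v + s⁻¹ • x) := by
      rw [smul_add, smul_smul, mul_inv_cancel₀ hs0, one_smul, add_comm]
    rw [h1, eval_smul_of_isHomogeneous hQ, ← haeval, hF]
    simp
  have := haeval x v 0
  rw [hG] at this
  exact hQx (by simpa using this.symm)

/-! ### Jacobian syzygies compared with the Euler field. -/

lemma pderiv_lin (v : Fin 3 → ℂ) (i : Fin 3) : pderiv i (lin v) = C (v i) := by
  fin_cases i <;> simp [lin_eq, pderiv_X]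

/-- The cross product of a triple of polynomials with the Euler vector field. -/
noncomputable def eulerCross (ρ : Fin 3 → MvPolynomial (Fin 3) ℂ) :
    Fin 3 → MvPolynomial (Fin 3) ℂ :=
  crossProduct ρ fun i => X i

lemma eulerCross_eq (ρ : Fin 3 → MvPolynomial (Fin 3) ℂ) :
    eulerCross ρ = ![ρ 1 * X 2 - ρ 2 * X 1, ρ 2 * X 0 - ρ 0 * X 2, ρ 0 * X 1 - ρ 1 * X 0] := rfl

lemma isHomogeneous_eulerCross {ρ : Fin 3 → MvPolynomial (Fin 3) ℂ} {k : ℕ}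
    (hρ : ∀ i, (ρ i).IsHomogeneous k) (i : Fin 3) : (eulerCross ρ i).IsHomogeneous (k + 1) := by
  have h : ∀ a b c e : Fin 3, (ρ a * X b - ρ c * X e).IsHomogeneous (k + 1) := fun a b c e =>
    ((hρ a).mul (isHomogeneous_X _ _)).sub ((hρ c).mul (isHomogeneous_X _ _))
  rw [eulerCross_eq]
  fin_cases i
  exacts [h _ _ _ _, h _ _ _ _, h _ _ _ _]

lemma isHomogeneous_definingPoly (A : Finset Line) : (definingPoly A).IsHomogeneous A.card :=
  isHomogeneous_prod_linearForm A

/-- Tangency: writing `f = ℓ g`, the Leibniz rule gives `ℓ ∣ g ρ(ℓ)`, and the prime `ℓ` does not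
divide `g`. -/
lemma IsJacobianSyzygy.lin_dvd {A : Finset Line} {ρ : Fin 3 → MvPolynomial (Fin 3) ℂ}
    (h : IsJacobianSyzygy (definingPoly A) ρ) {L : Line} (hL : L ∈ A) :
    lin L.rep ∣ ∑ i, C (L.rep i) * ρ i := by
  classical
  have hp := prime_lin L.rep_nonzero
  have hf : definingPoly A = lin L.rep * ∏ M ∈ A.erase L, linearForm M :=
    (Finset.mul_prod_erase A linearForm hL).symm
  have hg : ¬ lin L.rep ∣ ∏ M ∈ A.erase L, linearForm M := by
    rw [hp.dvd_finsetProd_iff]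
    rintro ⟨M, hM, hd⟩
    exact (Finset.mem_erase.1 hM).1 (lin_rep_dvd_iff.1 hd).symm
  refine (hp.dvd_or_dvd ?_).resolve_right hg
  refine ⟨-∑ i, ρ i * pderiv i (∏ M ∈ A.erase L, linearForm M), ?_⟩
  rw [IsJacobianSyzygy, hf] at h
  simp only [pderiv_mul, pderiv_lin, Fin.sum_univ_three] at h ⊢
  linear_combination h

/-- A Jacobian syzygy which becomes parallel to the Euler field on at least as many lines as the
degree of the cross product vanishes. -/
lemma eq_zero_of_lin_dvd_eulerCross {A : Finset Line} (hA : A.Nonempty)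
    {ρ : Fin 3 → MvPolynomial (Fin 3) ℂ} {k : ℕ} (hρ : ∀ i, (ρ i).IsHomogeneous k)
    (h : IsJacobianSyzygy (definingPoly A) ρ) {B : Finset Line} (hB : k + 1 ≤ B.card)
    (hdvd : ∀ L ∈ B, ∀ i, lin L.rep ∣ eulerCross ρ i) : ρ = 0 := by
  choose c hc using fun i => exists_eq_C_mul_prod (isHomogeneous_eulerCross hρ i) hB
    fun L hL => hdvd L hL i
  -- By degree, `ρ × E` is a constant vector `c` times the product over `B`; orthogonality to `E`
  -- then forces `lin c = 0`.
  have hX : ∑ i, X i * eulerCross ρ i = 0 := by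
    simp only [eulerCross_eq, Fin.sum_univ_three]
    simp
    ring
  have hc0 : c = 0 := by
    rw [← lin_eq_zero_iff]
    refine (mul_eq_zero.1 ?_).resolve_right (prod_linearForm_ne_zero B)
    rw [← hX, lin_eq]
    simp only [hc, Fin.sum_univ_three]
    ring
  have hW : ∀ i, eulerCross ρ i = 0 := fun i => by simp [hc i, hc0]
  have h0 := hW 0
  have h1 := hW 1
  have h2 := hW 2
  simp [eulerCross_eq] at h0 h1 h2
  -- Once `ρ × E = 0`, Euler's formula gives `d f ρ_j = X_j (ρ · ∇f) = 0`.
  have hE := (isHomogeneous_definingPoly A).sum_X_mul_pderiv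
  rw [IsJacobianSyzygy] at h
  simp only [Fin.sum_univ_three] at h hE
  have hd : (A.card • definingPoly A : MvPolynomial (Fin 3) ℂ) ≠ 0 :=
    smul_ne_zero hA.card_pos.ne' (prod_linearForm_ne_zero A)
  ext1 j
  refine (mul_eq_zero.1 ?_).resolve_right hd
  rw [← hE]
  fin_cases j <;> simp [-mul_eq_zero]
  · linear_combination X 0 * h + (pderiv 1 (definingPoly A)) * h2 - (pderiv 2 (definingPoly A)) * h1
  · linear_combination X 1 * h - (pderiv 0 (definingPoly A)) * h2 + (pderiv 2 (definingPoly A)) * h0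
  · linear_combination X 2 * h + (pderiv 0 (definingPoly A)) * h1 - (pderiv 1 (definingPoly A)) * h0

/-- The determinant of a point, a triple of polynomials, and the Euler vector field. -/
noncomputable def pointDet (p : Fin 3 → ℂ) (ρ : Fin 3 → MvPolynomial (Fin 3) ℂ) :
    MvPolynomial (Fin 3) ℂ :=
  ∑ i, C (p i) * eulerCross ρ i

lemma isHomogeneous_pointDet (p : Fin 3 → ℂ) {ρ : Fin 3 → MvPolynomial (Fin 3) ℂ} {k : ℕ}
    (hρ : ∀ i, (ρ i).IsHomogeneous k) : (pointDet p ρ).IsHomogeneous (k + 1) :=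
  IsHomogeneous.sum _ _ _ fun i _ => (isHomogeneous_eulerCross hρ i).C_mul _

/-- Expansion of the determinant along a covector. -/
lemma dvd_C_mul_pointDet_sub (α p : Fin 3 → ℂ) {ρ : Fin 3 → MvPolynomial (Fin 3) ℂ}
    (h : lin α ∣ ∑ i, C (α i) * ρ i) (i : Fin 3) :
    lin α ∣ C (α i) * pointDet p ρ - C (α ⬝ᵥ p) * eulerCross ρ i := by
  -- The identity is `α_i det(p, ρ, E) = (α·p)(ρ × E)_i + (α·ρ)(E × p)_i + (α·E)(p × ρ)_i`, with
  -- `α·E = lin α`.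
  have h1 : ∀ a b : MvPolynomial (Fin 3) ℂ,
      lin α ∣ (∑ i, C (α i) * ρ i) * a + lin α * b := fun a b =>
    dvd_add (h.mul_right _) (dvd_mul_right _ _)
  simp only [pointDet, eulerCross_eq, dotProduct, Fin.sum_univ_three, map_add, map_mul]
  fin_cases i
  · convert h1 (X 1 * C (p 2) - X 2 * C (p 1)) (C (p 1) * ρ 2 - C (p 2) * ρ 1) using 1
    simp [lin_eq, Fin.sum_univ_three]
    ring
  · convert h1 (X 2 * C (p 0) - X 0 * C (p 2)) (C (p 2) * ρ 0 - C (p 0) * ρ 2) using 1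
    simp [lin_eq, Fin.sum_univ_three]
    ring
  · convert h1 (X 0 * C (p 1) - X 1 * C (p 0)) (C (p 0) * ρ 1 - C (p 1) * ρ 0) using 1
    simp [lin_eq, Fin.sum_univ_three]
    ring

lemma IsJacobianSyzygy.lin_dvd_pointDet {A : Finset Line} {ρ : Fin 3 → MvPolynomial (Fin 3) ℂ}
    (h : IsJacobianSyzygy (definingPoly A) ρ) {L : Line} (hL : L ∈ A) {p : Point}
    (hp : OnLine p L) : lin L.rep ∣ pointDet p.rep ρ := by
  obtain ⟨i, hi⟩ := Function.ne_iff.1 L.rep_nonzero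
  have h1 := dvd_C_mul_pointDet_sub L.rep p.rep (h.lin_dvd hL) i
  rw [(onLine_iff p L).1 hp, C_0, zero_mul, sub_zero] at h1
  have hu : IsUnit (C (L.rep i) : MvPolynomial (Fin 3) ℂ) := (isUnit_iff_ne_zero.2 hi).map C
  exact hu.dvd_mul_left.1 h1

lemma IsJacobianSyzygy.lin_dvd_eulerCross {A : Finset Line}
    {ρ : Fin 3 → MvPolynomial (Fin 3) ℂ} (h : IsJacobianSyzygy (definingPoly A) ρ) {L : Line}
    (hL : L ∈ A) {p : Point} (hp : ¬ OnLine p L) (hdet : pointDet p.rep ρ = 0) (i : Fin 3) :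
    lin L.rep ∣ eulerCross ρ i := by
  have h1 := dvd_C_mul_pointDet_sub L.rep p.rep (h.lin_dvd hL) i
  rw [hdet, mul_zero, zero_sub, dvd_neg] at h1
  have hu : IsUnit (C (L.rep ⬝ᵥ p.rep) : MvPolynomial (Fin 3) ℂ) :=
    (isUnit_iff_ne_zero.2 (mt (onLine_iff p L).2 hp)).map C
  exact hu.dvd_mul_left.1 h1

/-- A Jacobian syzygy is parallel to the Euler field at the multiple points. -/
lemma IsJacobianSyzygy.eval_eulerCross {A : Finset Line}
    {ρ : Fin 3 → MvPolynomial (Fin 3) ℂ} (h : IsJacobianSyzygy (definingPoly A) ρ) {q : Point}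
    (hq : IsMultiplePoint A q) (i : Fin 3) : eval q.rep (eulerCross ρ i) = 0 := by
  classical
  obtain ⟨L, hL, M, hM, hLM⟩ := Finset.one_lt_card.1 hq
  rw [Finset.mem_filter] at hL hM
  set w : Fin 3 → ℂ := fun i => eval q.rep (eulerCross ρ i)
  -- Both `ρ(q)` and `q` are orthogonal to `N.rep`, so `w` is parallel to it; a nonzero `w` cannot
  -- be parallel to two distinct lines.
  have hcross : ∀ N ∈ A, OnLine q N → crossProduct w N.rep = 0 := by
    intro N hN hqN
    obtain ⟨s, hs⟩ := h.lin_dvd hN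
    have h1 := (onLine_iff q N).1 hqN
    have h2 := congr_arg (eval q.rep) hs
    rw [map_mul, eval_lin, h1, zero_mul] at h2
    simp only [dotProduct, Fin.sum_univ_three, map_add, map_mul, eval_C] at h1 h2
    rw [cross_apply]
    simp only [w, eulerCross_eq]
    ext j
    fin_cases j <;> simp
    · linear_combination q.rep 0 * h2 - eval q.rep (ρ 0) * h1
    · linear_combination q.rep 1 * h2 - eval q.rep (ρ 1) * h1
    · linear_combination q.rep 2 * h2 - eval q.rep (ρ 2) * h1
  by_contra hne
  have hw : w ≠ 0 := fun h0 => hne (congr_fun h0 i)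
  obtain ⟨a, ha⟩ := exists_smul_of_crossProduct_eq_zero hw (hcross L hL.1 hL.2)
  obtain ⟨b, hb⟩ := exists_smul_of_crossProduct_eq_zero hw (hcross M hM.1 hM.2)
  have ha0 : a ≠ 0 := by
    rintro rfl
    exact L.rep_nonzero (by simpa using ha)
  refine hLM (eq_of_rep_eq_smul (c := b * a⁻¹) ?_)
  rw [hb, ha, smul_smul, mul_assoc, inv_mul_cancel₀ ha0, mul_one]

/-- The minimal degree of a Jacobian syzygy is attained. -/
lemma exists_syzygy (A : Finset Line) : ∃ ρ : Fin 3 → MvPolynomial (Fin 3) ℂ, ρ ≠ 0 ∧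
    (∀ i, (ρ i).IsHomogeneous (firstExponent A)) ∧ IsJacobianSyzygy (definingPoly A) ρ := by
  set f := definingPoly A
  have hf := isHomogeneous_definingPoly A
  refine Nat.sInf_mem (s := {k : ℕ | ∃ ρ : Fin 3 → MvPolynomial (Fin 3) ℂ,
    ρ ≠ 0 ∧ (∀ i, (ρ i).IsHomogeneous k) ∧ IsJacobianSyzygy f ρ}) ?_
  by_cases h : pderiv 0 f = 0 ∧ pderiv 1 f = 0
  · refine ⟨0, ![1, 0, 0], fun h0 => by simpa using congr_fun h0 0, fun i => ?_, ?_⟩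
    · fin_cases i
      exacts [isHomogeneous_one _ _, isHomogeneous_zero _ _ _, isHomogeneous_zero _ _ _]
    · simp [IsJacobianSyzygy, Fin.sum_univ_three, h.1]
  · refine ⟨A.card - 1, ![pderiv 1 f, -pderiv 0 f, 0], fun h0 => h ⟨?_, ?_⟩, fun i => ?_, ?_⟩
    · simpa using congr_fun h0 1
    · simpa using congr_fun h0 0
    · fin_cases i
      exacts [hf.pderiv, hf.pderiv.neg, isHomogeneous_zero _ _ _]
    · simp [IsJacobianSyzygy, Fin.sum_univ_three]
      ring

/-! ### Incidences and the cover by lines off a point. -/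

lemma smallCover_of_covers {A B : Finset Line} (hBA : B ⊆ A)
    (hcard : B.card ≤ firstExponent A + 1) (hB : CoversMultiplePoints A B) : SmallCover A :=
  ⟨le_trans (Nat.sInf_le ⟨B, rfl, hB⟩) hcard, B, hBA, hcard, hB⟩

open Classical in
lemma card_filter_not_onLine (A : Finset Line) (p : Point) :
    mult A p + (A.filter fun L => ¬ OnLine p L).card = A.card :=
  Finset.card_filter_add_card_filter_not (s := A) fun L => OnLine p L

lemma exists_onLine_of_isMultiplePoint {A : Finset Line} {p : Point} (hp : IsMultiplePoint A p) :
    ∃ L ∈ A, ∃ M ∈ A, L ≠ M ∧ OnLine p L ∧ OnLine p M := by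
  classical
  obtain ⟨L, hL, M, hM, hLM⟩ := Finset.one_lt_card.1 hp
  rw [Finset.mem_filter] at hL hM
  exact ⟨L, hL.1, M, hM.1, hLM, hL.2, hM.2⟩

lemma isMultiplePoint_of_onLine {A : Finset Line} {p : Point} {L M : Line} (hL : L ∈ A)
    (hM : M ∈ A) (hLM : L ≠ M) (hpL : OnLine p L) (hpM : OnLine p M) : IsMultiplePoint A p := by
  classical
  exact Finset.one_lt_card.2
    ⟨L, Finset.mem_filter.2 ⟨hL, hpL⟩, M, Finset.mem_filter.2 ⟨hM, hpM⟩, hLM⟩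

/-- Two distinct lines have at most one common point. -/
lemma eq_of_onLine {p q : Point} {L M : Line} (hLM : L ≠ M) (hpL : OnLine p L)
    (hpM : OnLine p M) (hqL : OnLine q L) (hqM : OnLine q M) : p = q := by
  by_contra hpq
  rw [onLine_iff] at hpL hpM hqL hqM
  refine hLM (lin_rep_dvd_iff.1 (lin_dvd_of_eval_eq_zero L.rep_nonzero fun x hx => ?_))
  obtain ⟨a, b, rfl⟩ := exists_eq_smul_add_smul L.rep_nonzero hpL hqL hx q.rep_nonzero
    fun b hb => hpq (eq_of_rep_eq_smul hb).symm
  simp [eval_lin, dotProduct_add, hpM, hqM]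

lemma exists_onLine_onLine {L M : Line} (hLM : L ≠ M) : ∃ p : Point, OnLine p L ∧ OnLine p M := by
  classical
  exact ⟨Projectivization.cross L M, Projectivization.cross_orthogonal_left hLM,
    Projectivization.cross_orthogonal_right hLM⟩

/-- The lines not through a multiple point `p`, and one line through `p`, contain all multiple
points. -/
lemma smallCover_of_card_le {A : Finset Line} {p : Point} (hp : IsMultiplePoint A p)
    (h : A.card ≤ firstExponent A + mult A p) : SmallCover A := by
  classical
  obtain ⟨L, hL, -, -, -, hpL, -⟩ := exists_onLine_of_isMultiplePoint hp
  have hc := card_filter_not_onLine A p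
  refine smallCover_of_covers (B := insert L (A.filter fun L => ¬ OnLine p L))
    (Finset.insert_subset hL (Finset.filter_subset _ _))
    ((Finset.card_insert_le _ _).trans (by omega)) fun q hq => ?_
  by_cases hqp : q = p
  · exact ⟨L, Finset.mem_insert_self _ _, hqp ▸ hpL⟩
  obtain ⟨M, hM, N, hN, hMN, hqM, hqN⟩ := exists_onLine_of_isMultiplePoint hq
  by_cases hpM : OnLine p M
  · have hpN : ¬ OnLine p N := fun hpN => hqp (eq_of_onLine hMN hqM hqN hpM hpN)
    exact ⟨N, Finset.mem_insert_of_mem (Finset.mem_filter.2 ⟨hN, hpN⟩), hqN⟩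
  · exact ⟨M, Finset.mem_insert_of_mem (Finset.mem_filter.2 ⟨hM, hpM⟩), hqM⟩

/-! ### Multiplicity against `d₁`, and covers by the lines through a point. -/

/-- Were the determinant zero, all lines off `p`, at least `k + 1` of them, would divide `ρ × E`. -/
lemma pointDet_ne_zero {A : Finset Line} (hA : A.Nonempty) {ρ : Fin 3 → MvPolynomial (Fin 3) ℂ}
    {k : ℕ} (hρ0 : ρ ≠ 0) (hρ : ∀ i, (ρ i).IsHomogeneous k)
    (h : IsJacobianSyzygy (definingPoly A) ρ) {p : Point} (hk : k + mult A p < A.card) :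
    pointDet p.rep ρ ≠ 0 := by
  classical
  intro hdet
  have hc := card_filter_not_onLine A p
  refine hρ0 (eq_zero_of_lin_dvd_eulerCross hA hρ h
    (B := A.filter fun L => ¬ OnLine p L) (by omega) fun L hL i => ?_)
  rw [Finset.mem_filter] at hL
  exact h.lin_dvd_eulerCross hL.1 hL.2 hdet i

lemma mult_le_firstExponent_add_one {A : Finset Line} (hA : A.Nonempty) {p : Point}
    (hk : firstExponent A + mult A p < A.card) : mult A p ≤ firstExponent A + 1 := by
  classical
  obtain ⟨ρ, hρ0, hρ, h⟩ := exists_syzygy A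
  refine card_le_of_isHomogeneous (isHomogeneous_pointDet p.rep hρ)
    (pointDet_ne_zero hA hρ0 hρ h hk) fun L hL => ?_
  rw [Finset.mem_filter] at hL
  exact h.lin_dvd_pointDet hL.1 hL.2

open Classical in
/-- A point of multiplicity `d₁ + 1` is modular if `d₁` is small. -/
lemma covers_lines_through {A : Finset Line} (hA : A.Nonempty) {p : Point}
    (hp : firstExponent A + 1 = mult A p) (hk : firstExponent A + mult A p < A.card) :
    CoversMultiplePoints A (A.filter fun L => OnLine p L) := by
  obtain ⟨ρ, hρ0, hρ, h⟩ := exists_syzygy A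
  obtain ⟨c, hc⟩ := exists_eq_C_mul_prod (isHomogeneous_pointDet p.rep hρ)
    (B := A.filter fun L => OnLine p L) hp.le fun L hL => by
      rw [Finset.mem_filter] at hL
      exact h.lin_dvd_pointDet hL.1 hL.2
  have hc0 : c ≠ 0 := by
    rintro rfl
    exact pointDet_ne_zero hA hρ0 hρ h hk (by simp [hc])
  intro q hq
  have h0 : eval q.rep (pointDet p.rep ρ) = 0 := by
    rw [pointDet, map_sum]
    exact Finset.sum_eq_zero fun i _ => by rw [map_mul, h.eval_eulerCross hq, mul_zero]
  rw [hc, map_mul, eval_C, map_prod, mul_eq_zero, Finset.prod_eq_zero_iff] at h0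
  obtain ⟨L, hL, hLq⟩ := h0.resolve_left hc0
  rw [linearForm_eq_lin, eval_lin] at hLq
  exact ⟨L, hL, (onLine_iff q L).2 hLq⟩

lemma smallCover_of_firstExponent {A : Finset Line} (hA : A.Nonempty) {p : Point}
    (hp : IsMultiplePoint A p) (h : firstExponent A + 1 = mult A p) : SmallCover A := by
  classical
  rcases le_or_gt A.card (firstExponent A + mult A p) with hk | hk
  · exact smallCover_of_card_le hp hk
  · exact smallCover_of_covers (Finset.filter_subset _ _) h.ge (covers_lines_through hA h hk)

lemma smallCover_of_isModularPoint {A : Finset Line} (hA : A.Nonempty) {p : Point}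
    (hp : IsModularPoint A p) : SmallCover A := by
  classical
  rcases le_or_gt A.card (firstExponent A + mult A p) with hk | hk
  · exact smallCover_of_card_le hp.1 hk
  refine smallCover_of_covers (B := A.filter fun L => OnLine p L) (Finset.filter_subset _ _)
    (mult_le_firstExponent_add_one hA hk) fun q hq => ?_
  by_cases hqp : q = p
  · obtain ⟨L, hL, -, -, -, hpL, -⟩ := exists_onLine_of_isMultiplePoint hp.1
    exact ⟨L, Finset.mem_filter.2 ⟨hL, hpL⟩, hqp ▸ hpL⟩
  · obtain ⟨L, hL, hpL, hqL⟩ := hp.2 q hqp hq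
    exact ⟨L, Finset.mem_filter.2 ⟨hL, hpL⟩, hqL⟩

/-! ### Arrangements with only double and triple points. -/

open Classical in
/-- The multiple points on a line of an arrangement without points of multiplicity above three:
with the triple ones counted twice, there are `d - 1` of them. -/
lemma exists_multiplePoints_on_line {A : Finset Line}
    (h3 : ∀ p, IsMultiplePoint A p → mult A p = 2 ∨ mult A p = 3) {L : Line} (hL : L ∈ A) :
    ∃ T : Finset Point, (∀ t ∈ T, OnLine t L ∧ IsMultiplePoint A t) ∧
      A.card ≤ T.card + (T.filter fun t => mult A t = 3).card + 1 := by
  have hinter : ∀ M ∈ A.erase L, ∃ p : Point, OnLine p L ∧ OnLine p M := fun M hM =>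
    exists_onLine_onLine (Finset.ne_of_mem_erase hM).symm
  choose! φ hφL hφM using hinter
  have hT : ∀ t ∈ (A.erase L).image φ, OnLine t L ∧ IsMultiplePoint A t := by
    intro t ht
    obtain ⟨M, hM, rfl⟩ := Finset.mem_image.1 ht
    exact ⟨hφL M hM, isMultiplePoint_of_onLine hL (Finset.mem_of_mem_erase hM)
      (Finset.ne_of_mem_erase hM).symm (hφL M hM) (hφM M hM)⟩
  refine ⟨(A.erase L).image φ, hT, ?_⟩
  -- The fibre over `t` consists of lines through `t` other than `L`, so it has at most `mult A t -
  -- 1` elements.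
  have hfib : ∀ t ∈ (A.erase L).image φ, ((A.erase L).filter fun M => φ M = t).card ≤
      1 + if mult A t = 3 then 1 else 0 := by
    intro t ht
    have hsub : insert L ((A.erase L).filter fun M => φ M = t) ⊆
        A.filter fun M => OnLine t M := by
      intro M hM
      rcases Finset.mem_insert.1 hM with rfl | hM
      · exact Finset.mem_filter.2 ⟨hL, (hT t ht).1⟩
      · obtain ⟨hMA, rfl⟩ := Finset.mem_filter.1 hM
        exact Finset.mem_filter.2 ⟨Finset.mem_of_mem_erase hMA, hφM M hMA⟩
    have hle := Finset.card_le_card hsub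
    rw [Finset.card_insert_of_notMem (by simp)] at hle
    change _ ≤ mult A t at hle
    rcases h3 t (hT t ht).2 with h | h <;> simp [h] at hle ⊢ <;> omega
  have hsum := Finset.sum_le_sum hfib
  rw [← Finset.card_eq_sum_card_image, Finset.sum_add_distrib, ← Finset.card_filter,
    Finset.card_erase_of_mem hL] at hsum
  simp only [Finset.sum_const, smul_eq_mul, mul_one] at hsum
  omega

/-- A Jacobian syzygy is parallel to the Euler field along a line with many multiple points. -/
lemma IsJacobianSyzygy.lin_dvd_eulerCross_of_card {A : Finset Line}
    {ρ : Fin 3 → MvPolynomial (Fin 3) ℂ} {k : ℕ} (hρ : ∀ i, (ρ i).IsHomogeneous k)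
    (h : IsJacobianSyzygy (definingPoly A) ρ) {L : Line} {T : Finset Point}
    (hT : ∀ t ∈ T, OnLine t L ∧ IsMultiplePoint A t) (hk : k + 1 < T.card) (i : Fin 3) :
    lin L.rep ∣ eulerCross ρ i :=
  lin_dvd_of_zeros (isHomogeneous_eulerCross hρ i) hk (fun t ht => (hT t ht).1)
    fun t ht => h.eval_eulerCross (hT t ht).2 i

/-- Each line carries at least `d - 1` double points; if `d - 1 > d₁ + 1`, every line divides `ρ ×
E`. -/
lemma card_le_firstExponent_add_two {A : Finset Line} (hA : A.Nonempty)
    (h2 : ∀ p, IsMultiplePoint A p → mult A p = 2) : A.card ≤ firstExponent A + 2 := by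
  classical
  obtain ⟨ρ, hρ0, hρ, h⟩ := exists_syzygy A
  by_contra! hlt
  refine hρ0 (eq_zero_of_lin_dvd_eulerCross hA hρ h (B := A) (by omega) fun L hL i => ?_)
  obtain ⟨T, hT, hcard⟩ := exists_multiplePoints_on_line (fun p hp => Or.inl (h2 p hp)) hL
  rw [Finset.filter_false_of_mem fun t ht => by rw [h2 t (hT t ht).2]; decide,
    Finset.card_empty] at hcard
  exact h.lin_dvd_eulerCross_of_card hρ hT (by omega) i

open Classical in
/-- At most `n choose 2` lines contain two or more of `n` points. -/
lemma card_filter_one_lt_le (A : Finset Line) (S : Finset Point) :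
    (A.filter fun L => 1 < (S.filter fun t => OnLine t L).card).card ≤ S.card.choose 2 := by
  have hpair : ∀ L ∈ A.filter fun L => 1 < (S.filter fun t => OnLine t L).card,
      ∃ P ⊆ S.filter fun t => OnLine t L, P.card = 2 := fun L hL =>
    Finset.exists_subset_card_eq (Finset.mem_filter.1 hL).2
  choose! P hPS hP using hpair
  rw [← Finset.card_powersetCard]
  -- Sending a line to a chosen pair of its points is injective, since two points determine the
  -- line.
  refine Finset.card_le_card_of_injOn P (fun L hL => ?_) fun L hL M hM hLM => ?_
  · exact Finset.mem_powersetCard.2 ⟨(hPS L hL).trans (Finset.filter_subset _ _), hP L hL⟩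
  · obtain ⟨p, hp, q, hq, hpq⟩ := Finset.one_lt_card.1 (by rw [hP L hL]; decide : 1 < (P L).card)
    by_contra hne
    have hpM := (Finset.mem_filter.1 (hPS M hM (hLM ▸ hp))).2
    have hqM := (Finset.mem_filter.1 (hPS M hM (hLM ▸ hq))).2
    exact hpq (eq_of_onLine hne (Finset.mem_filter.1 (hPS L hL hp)).2 hpM
      (Finset.mem_filter.1 (hPS L hL hq)).2 hqM)

/-- At most three lines contain two points of `S`. Each of the remaining `d - 3` or more carries at
least `d - 2` multiple points, so `d ≥ d₁ + 4` would yield `d₁ + 1` lines dividing `ρ × E`. -/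
lemma card_le_firstExponent_add_three {A : Finset Line} (hA : A.Nonempty)
    (h3 : ∀ p, IsMultiplePoint A p → mult A p = 2 ∨ mult A p = 3) {S : Finset Point}
    (hS : ∀ p, mult A p = 3 → p ∈ S) (hS3 : S.card ≤ 3) : A.card ≤ firstExponent A + 3 := by
  classical
  obtain ⟨ρ, hρ0, hρ, h⟩ := exists_syzygy A
  by_contra! hlt
  have hbad := (card_filter_one_lt_le A S).trans (Nat.choose_le_choose 2 hS3)
  have hsplit := Finset.card_filter_add_card_filter_not (s := A)
    fun L => 1 < (S.filter fun t => OnLine t L).card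
  rw [show Nat.choose 3 2 = 3 from rfl] at hbad
  refine hρ0 (eq_zero_of_lin_dvd_eulerCross hA hρ h
    (B := A.filter fun L => ¬ 1 < (S.filter fun t => OnLine t L).card) (by omega) fun L hL i => ?_)
  obtain ⟨hL, hLS⟩ := Finset.mem_filter.1 hL
  obtain ⟨T, hT, hcard⟩ := exists_multiplePoints_on_line h3 hL
  have hsub : (T.filter fun t => mult A t = 3) ⊆ S.filter fun t => OnLine t L := by
    intro t ht
    rw [Finset.mem_filter] at ht ⊢
    exact ⟨hS t ht.2, (hT t ht.1).1⟩
  have := Finset.card_le_card hsub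
  exact h.lin_dvd_eulerCross_of_card hρ hT (by omega) i

lemma isPencil_of_card_le_mult {A : Finset Line} {p : Point} (h : A.card ≤ mult A p) :
    IsPencil A := by
  classical
  exact ⟨p, Finset.filter_eq_self.1 (Finset.eq_of_subset_of_card_le (Finset.filter_subset _ _) h)⟩

lemma exists_isMultiplePoint {A : Finset Line} (h : 2 ≤ A.card) : ∃ p, IsMultiplePoint A p := by
  obtain ⟨L, hL, M, hM, hLM⟩ := Finset.one_lt_card.1 h
  obtain ⟨p, hpL, hpM⟩ := exists_onLine_onLine hLM
  exact ⟨p, isMultiplePoint_of_onLine hL hM hLM hpL hpM⟩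

end LineArrangement

theorem theorem1p16 (A : Finset LineArrangement.Line) (hA : ¬ LineArrangement.IsPencil A) :
    -- the general statement
    (∀ p : LineArrangement.Point, 2 ≤ LineArrangement.mult A p →
      (LineArrangement.firstExponent A + 1 = LineArrangement.mult A p ∨
        LineArrangement.firstExponent A + LineArrangement.mult A p = A.card) →
      LineArrangement.SmallCover A) ∧
    -- only double points
    (3 ≤ A.card →
      (∀ p : LineArrangement.Point, LineArrangement.IsMultiplePoint A p →
        LineArrangement.mult A p = 2) →
      LineArrangement.SmallCover A) ∧
    -- only double points, except for one, two or three triple points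
    (4 ≤ A.card →
      (∀ p : LineArrangement.Point, LineArrangement.IsMultiplePoint A p →
        LineArrangement.mult A p = 2 ∨ LineArrangement.mult A p = 3) →
      1 ≤ {p : LineArrangement.Point | LineArrangement.mult A p = 3}.ncard →
      {p : LineArrangement.Point | LineArrangement.mult A p = 3}.ncard ≤ 3 →
      LineArrangement.SmallCover A) ∧
    -- a point of multiplicity at least half the number of lines
    ((∃ p : LineArrangement.Point, A.card ≤ 2 * LineArrangement.mult A p) →
      LineArrangement.SmallCover A) ∧
    -- supersolvable arrangements
    (LineArrangement.IsSupersolvable A → LineArrangement.SmallCover A) := by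
  open LineArrangement in
  have hne : A.Nonempty := by
    rw [Finset.nonempty_iff_ne_empty]
    rintro rfl
    exact hA ⟨Projectivization.mk ℂ (fun _ => 1) fun h => one_ne_zero (congr_fun h 0), by simp⟩
  refine ⟨fun p hp h => ?_, fun hcard h2 => ?_, fun hcard h3 hn1 hn3 => ?_, ?_, ?_⟩
  · rcases h with h | h
    · exact smallCover_of_firstExponent hne hp h
    · exact smallCover_of_card_le hp h.ge
  · obtain ⟨p, hp⟩ := exists_isMultiplePoint (by omega : 2 ≤ A.card)
    exact smallCover_of_card_le hp (h2 p hp ▸ card_le_firstExponent_add_two hne h2)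
  · have hfin : {p : Point | mult A p = 3}.Finite := Set.finite_of_ncard_pos hn1
    obtain ⟨p, hp⟩ : {p : Point | mult A p = 3}.Nonempty := (Set.ncard_pos hfin).1 hn1
    have hp3 : mult A p = 3 := hp
    refine smallCover_of_card_le (p := p) (by rw [IsMultiplePoint, hp3]; decide) ?_
    rw [hp3]
    refine card_le_firstExponent_add_three hne h3 (S := hfin.toFinset) (by simp) ?_
    rwa [← Set.ncard_eq_toFinset_card _ hfin]
  · rintro ⟨p, hp⟩
    have hlt : mult A p < A.card := not_le.1 fun h => hA (isPencil_of_card_le_mult h)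
    have hp2 : IsMultiplePoint A p := by
      -- If `m ≤ 1`, then `m < d ≤ 2m` leaves only `d = 2`, and two lines always form a pencil.
      by_contra hp2
      have hA2 : A.card = 2 := by rw [IsMultiplePoint] at hp2; omega
      classical
      obtain ⟨L, M, hLM, rfl⟩ := Finset.card_eq_two.1 hA2
      obtain ⟨q, hqL, hqM⟩ := exists_onLine_onLine hLM
      exact hA ⟨q, by simp [hqL, hqM]⟩
    rcases le_or_gt A.card (firstExponent A + mult A p) with hk | hk
    · exact smallCover_of_card_le hp2 hk
    -- Here `d₁ + m < d ≤ 2m` gives `d₁ + 1 ≤ m`, so equality holds.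
    · have := mult_le_firstExponent_add_one hne hk
      exact smallCover_of_firstExponent hne hp2 (by omega)
  · rintro ⟨p, hp⟩
    exact smallCover_of_isModularPoint hne hp
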